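/- Let $d \ge 1$ be an integer. A \emph{distribution} on $\mathbb{R}^d$ is a Borel probability measure on $\mathbb{R}^d$; its characteristic function is $\widehat{\mu}(t) = \int_{\mathbb{R}^d} e^{i\langle t, z\rangle}\,\mu(dz)$, $t \in \mathbb{R}^d$. A distribution $\mu$ on $\mathbb{R}^d$ is \emph{infinitely divisible} if for every integer $n \ge 1$ there is a distribution $\nu$ on $\mathbb{R}^d$ whose $n$-fold convolution with itself is $\mu$, and it is \emph{quasi-infinitely divisible} if $\widehat{\mu} = \widehat{\mu_1}/\widehat{\mu_2}$ for some infinitely divisible distributions $\mu_1$ and $\mu_2$ on $\mathbb{R}^d$. Then the following statements are equivalent: (i) The class of quasi-infinitely divisible distributions on $\mathbb{R}^d$ is dense in the class of all distributions on $\mathbb{R}^d$ with respect to weak convergence. (ii) For every distribution $\mu$ on $\mathbb{R}^d$ there is a sequence of zero-free continuous functions $f_n : \mathbb{R}^d \to \mathbb{C}$ that converges to $\widehat{\mu}$ locally uniformly on $\mathbb{R}^d$. (iii) $d = 1$. -/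

import Mathlib

open MeasureTheory Filter Topology

noncomputable section

/-- The `n`-fold convolution `ν ∗ ⋯ ∗ ν` of a measure with itself (the Dirac measure at `0` for
`n = 0`). -/
def convPow {E : Type*} [AddMonoid E] [MeasurableSpace E] (ν : Measure E) : ℕ → Measure E
  | 0 => Measure.dirac 0
  | n + 1 => Measure.conv (convPow ν n) ν

/-- A distribution `μ` on `ℝ^d` is infinitely divisible if for every `n ≥ 1` there is a distribution
`ν` on `ℝ^d` whose `n`-fold convolution is `μ`. -/
def IsInfinitelyDivisible {d : ℕ} (μ : ProbabilityMeasure (EuclideanSpace ℝ (Fin d))) : Prop :=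
  ∀ n : ℕ, 1 ≤ n → ∃ ν : ProbabilityMeasure (EuclideanSpace ℝ (Fin d)),
    convPow (ν : Measure (EuclideanSpace ℝ (Fin d))) n = (μ : Measure (EuclideanSpace ℝ (Fin d)))

/-- A distribution `μ` on `ℝ^d` is quasi-infinitely divisible if its characteristic function is the
quotient of the characteristic functions of two infinitely divisible distributions. (Characteristic
functions of infinitely divisible distributions have no zeros, so the division is genuine.) -/
def IsQuasiInfinitelyDivisible {d : ℕ}
    (μ : ProbabilityMeasure (EuclideanSpace ℝ (Fin d))) : Prop :=
  ∃ μ₁ μ₂ : ProbabilityMeasure (EuclideanSpace ℝ (Fin d)),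
    IsInfinitelyDivisible μ₁ ∧ IsInfinitelyDivisible μ₂ ∧
    ∀ t : EuclideanSpace ℝ (Fin d),
      charFun (μ : Measure (EuclideanSpace ℝ (Fin d))) t =
        charFun (μ₁ : Measure (EuclideanSpace ℝ (Fin d))) t /
          charFun (μ₂ : Measure (EuclideanSpace ℝ (Fin d))) t

/-- `φ` is the locally uniform limit of a sequence of zero-free continuous complex-valued functions
on `ℝ^d`. -/
def IsLocalUniformLimitOfZeroFree {d : ℕ} (φ : EuclideanSpace ℝ (Fin d) → ℂ) : Prop :=
  ∃ f : ℕ → EuclideanSpace ℝ (Fin d) → ℂ,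
    (∀ n, Continuous (f n)) ∧ (∀ n t, f n t ≠ 0) ∧ TendstoLocallyUniformly f φ atTop

end

/-! ### Characteristic functions, compound Poisson laws and a doubling inequality -/

section CharFun

/-! Density gives zero-free approximation because infinitely divisible laws have zero-free
characteristic functions (`IsInfinitelyDivisible.charFun_ne_zero`), hence so do quasi-infinitely
divisible ones, and weak convergence makes characteristic functions converge locally uniformly
(`tendstoLocallyUniformly_charFun`).

Zero-free approximation forces `d = 1` by a winding argument. For `d ≥ 2` some three-atom law has,
on a plane, the characteristic function `(2 cos x + exp (iy)) / 3`, which winds once around `0`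
along the boundary of a rectangle. Any uniformly close continuous function winds too and must vanish
inside (`exists_zero_of_half_planes`).

On the line, every law is a weak limit of laws on finite arithmetic progressions, whose
characteristic functions are, up to a phase, polynomials `p` in `exp (iht)`. Tilting the weights by
`r ^ k` with `r` slightly above `1` moves the roots of `p` off the unit circle. Factoring `p` and
expanding logarithms then gives a phase times the exponential of an absolutely convergent Fourier
series. Hermitian symmetry makes its coefficients real, and splitting them by sign yields a quotient
of compound Poisson characteristic functions, up to a shift
(`isQuasiInfinitelyDivisible_of_charFun_eq_eval`). -/

lemma charFun_smul_measure {E : Type*} [MeasurableSpace E] [Inner ℝ E] (c : ENNReal)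
    (ν : Measure E) (t : E) : charFun (c • ν) t = c.toReal * charFun ν t := by
  simp [charFun_apply, integral_smul_measure]

variable {E : Type*} [NormedAddCommGroup E] [InnerProductSpace ℝ E] [MeasurableSpace E]
  [BorelSpace E]

lemma integrable_exp_inner [SecondCountableTopology E] (ν : Measure E) [IsFiniteMeasure ν] (t : E) :
    Integrable (fun x : E ↦ Complex.exp ((inner ℝ x t : ℝ) * Complex.I)) ν :=
  (integrable_const (1 : ℝ)).mono (by fun_prop) (by simp)

lemma hasSum_charFun_sum [SecondCountableTopology E] {ι : Type*} (ν : ι → Measure E)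
    [IsFiniteMeasure (Measure.sum ν)] (t : E) :
    HasSum (fun i ↦ charFun (ν i) t) (charFun (Measure.sum ν) t) :=
  hasSum_integral_measure (integrable_exp_inner _ t)

lemma continuous_charFun [SecondCountableTopology E] (ν : Measure E) [IsFiniteMeasure ν] :
    Continuous (charFun ν) := by
  unfold charFun
  refine continuous_of_dominated (bound := fun _ ↦ 1) (fun t ↦ by fun_prop)
    (fun t ↦ by simp) (integrable_const _) (ae_of_all _ fun x ↦ by fun_prop)

instance isFiniteMeasure_convPow [SecondCountableTopology E] (ν : Measure E) [IsFiniteMeasure ν]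
    (n : ℕ) : IsFiniteMeasure (convPow ν n) := by
  induction n with
  | zero => unfold convPow; infer_instance
  | succ n ih => unfold convPow; infer_instance

lemma charFun_convPow [SecondCountableTopology E] (ν : Measure E) [IsFiniteMeasure ν]
    (n : ℕ) (t : E) : charFun (convPow ν n) t = charFun ν t ^ n := by
  induction n with
  | zero => simp [convPow]
  | succ n ih => simp [convPow, charFun_conv, ih, pow_succ]

/-- The distribution with finitely many atoms `x i` of weights `w i`. -/
lemma exists_charFun_eq_sum {ι : Type*} (s : Finset ι) {w : ι → ℝ}
    (hw : ∀ i, 0 ≤ w i) (hsum : ∑ i ∈ s, w i = 1) (x : ι → E) : ∃ μ : ProbabilityMeasure E,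
      ∀ t, charFun (μ : Measure E) t
        = ∑ i ∈ s, (w i : ℂ) * Complex.exp ((inner ℝ (x i) t : ℝ) * Complex.I) := by
  refine ⟨⟨∑ i ∈ s, ENNReal.ofReal (w i) • Measure.dirac (x i), ⟨?_⟩⟩, fun t ↦ ?_⟩
  · simp [Measure.finsetSum_apply, ← ENNReal.ofReal_sum_of_nonneg fun i _ ↦ hw i, hsum]
  · simp only [ProbabilityMeasure.coe_mk, charFun_apply]
    rw [integral_finsetSum_measure fun i _ ↦ ?_]
    · simp [integral_smul_measure, ENNReal.toReal_ofReal (hw _)]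
    · exact (integrable_dirac (by simp)).smul_measure ENNReal.ofReal_ne_top

/-- The compound Poisson distribution with Lévy measure `ν`. -/
lemma exists_compoundPoisson [SecondCountableTopology E] (ν : Measure E) [IsFiniteMeasure ν] :
    ∃ μ : ProbabilityMeasure E, ∀ t,
      charFun (μ : Measure E) t = Complex.exp (charFun ν t - ν.real Set.univ) := by
  set l : ℝ := ν.real Set.univ
  -- `ν` is not normalised: the factor `l ^ n` of the Poisson weights is carried by the mass of
  -- `convPow ν n`.
  let w : ℕ → ENNReal := fun n ↦ ENNReal.ofReal (Real.exp (-l) / n.factorial)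
  let P : Measure E := Measure.sum fun n ↦ w n • convPow ν n
  have hw (n : ℕ) : (w n).toReal = Real.exp (-l) / n.factorial :=
    ENNReal.toReal_ofReal (by positivity)
  have hmass (n : ℕ) : (convPow ν n) Set.univ = ENNReal.ofReal (l ^ n) := by
    have h := charFun_convPow ν n 0
    rw [charFun_zero, charFun_zero] at h
    have h' : (convPow ν n).real Set.univ = l ^ n := by exact_mod_cast h
    rw [← h', ofReal_measureReal]
  have hexp : HasSum (fun n : ℕ ↦ Real.exp (-l) / n.factorial * l ^ n) 1 := by
    have h := (NormedSpace.expSeries_div_hasSum_exp l).mul_left (Real.exp (-l))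
    rw [← Real.exp_eq_exp_ℝ, ← Real.exp_add] at h
    simp only [neg_add_cancel, Real.exp_zero] at h
    refine h.congr_fun fun n ↦ by ring
  have hP : IsProbabilityMeasure P := by
    constructor
    rw [Measure.sum_apply _ MeasurableSet.univ]
    have (n : ℕ) : (w n • convPow ν n) Set.univ
        = ENNReal.ofReal (Real.exp (-l) / n.factorial * l ^ n) := by
      rw [Measure.smul_apply, hmass, smul_eq_mul, ← ENNReal.ofReal_mul (by positivity)]
    simp_rw [this]
    rw [← ENNReal.ofReal_tsum_of_nonneg (fun n ↦ by positivity) hexp.summable, hexp.tsum_eq,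
      ENNReal.ofReal_one]
  refine ⟨⟨P, hP⟩, fun t ↦ ?_⟩
  have h1 := hasSum_charFun_sum (fun n ↦ w n • convPow ν n) t
  simp only [charFun_smul_measure, hw, charFun_convPow] at h1
  have h2 := (NormedSpace.expSeries_div_hasSum_exp (charFun ν t)).mul_left (Complex.exp (-l))
  rw [← Complex.exp_eq_exp_ℂ, ← Complex.exp_add] at h2
  refine (h1.unique (h2.congr_fun fun n ↦ ?_)).trans (by congr 1; ring)
  push_cast
  ring

/-- Symmetrisation: convolving with the reflected law multiplies the characteristic function by its
conjugate. -/
lemma exists_charFun_eq_normSq [SecondCountableTopology E] (μ : Measure E)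
    [IsProbabilityMeasure μ] : ∃ ρ : Measure E, IsProbabilityMeasure ρ ∧
      ∀ t, charFun ρ t = (Complex.normSq (charFun μ t) : ℂ) := by
  have : IsProbabilityMeasure (μ.map ((-1 : ℝ) • ·)) :=
    Measure.isProbabilityMeasure_map (by fun_prop)
  refine ⟨Measure.conv μ (μ.map ((-1 : ℝ) • ·)), inferInstance, fun t ↦ ?_⟩
  rw [charFun_conv, charFun_map_smul, neg_one_smul, charFun_neg, Complex.mul_conj]

lemma one_sub_re_charFun [SecondCountableTopology E] (μ : Measure E) [IsProbabilityMeasure μ]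
    (t : E) : 1 - (charFun μ t).re = ∫ x, (1 - Real.cos (inner ℝ x t)) ∂μ := by
  have hi : Integrable (fun x : E ↦ Real.cos (inner ℝ x t)) μ :=
    (integrable_const (1 : ℝ)).mono (by fun_prop) (by simp [Real.abs_cos_le_one])
  rw [integral_sub (integrable_const _) hi, charFun_apply]
  have := integral_re (integrable_exp_inner μ t)
  simp only [RCLike.re_to_complex, Complex.exp_ofReal_mul_I_re] at this
  simp [this]

/-- Integrates `1 - cos 2a ≤ 4 (1 - cos a)`; the difference of the two sides is `2 (1 - cos a) ^ 2`.
-/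
lemma one_sub_re_charFun_two_smul_le [SecondCountableTopology E] (μ : Measure E)
    [IsProbabilityMeasure μ] (t : E) :
    1 - (charFun μ ((2 : ℝ) • t)).re ≤ 4 * (1 - (charFun μ t).re) := by
  rw [one_sub_re_charFun, one_sub_re_charFun, ← integral_const_mul]
  have hi (t : E) : Integrable (fun x : E ↦ 1 - Real.cos (inner ℝ x t)) μ :=
    (integrable_const _).sub
      ((integrable_const (1 : ℝ)).mono (by fun_prop) (by simp [Real.abs_cos_le_one]))
  refine integral_mono (hi _) ((hi _).const_mul _) fun x ↦ ?_
  simp only [inner_smul_right, Real.cos_two_mul]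
  nlinarith [sq_nonneg (Real.cos (inner ℝ x t) - 1)]

lemma one_sub_normSq_charFun_two_smul_le [SecondCountableTopology E] (μ : Measure E)
    [IsProbabilityMeasure μ] (t : E) :
    1 - ‖charFun μ ((2 : ℝ) • t)‖ ^ 2 ≤ 4 * (1 - ‖charFun μ t‖ ^ 2) := by
  obtain ⟨ρ, _, hρ⟩ := exists_charFun_eq_normSq μ
  simpa [hρ, Complex.normSq_eq_norm_sq, ← Complex.ofReal_pow] using
    one_sub_re_charFun_two_smul_le ρ t

end CharFun

/-! ### Infinitely divisible laws -/

section InfinitelyDivisible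

variable {d : ℕ}

local notation "𝔼" => EuclideanSpace ℝ (Fin d)

lemma isInfinitelyDivisible_iff {μ : ProbabilityMeasure 𝔼} :
    IsInfinitelyDivisible μ ↔ ∀ n : ℕ, 1 ≤ n → ∃ ν : ProbabilityMeasure 𝔼,
      ∀ t, charFun (ν : Measure 𝔼) t ^ n = charFun (μ : Measure 𝔼) t := by
  refine forall₂_congr fun n _ ↦ exists_congr fun ν ↦ ⟨fun h t ↦ ?_, fun h ↦ ?_⟩
  · rw [← h, charFun_convPow]
  · exact Measure.ext_of_charFun (funext fun t ↦ by rw [charFun_convPow, h])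

/-- The doubling inequality, applied to convolution roots of high order, carries nonvanishing from
`s` to `2s`. Continuity at `0` gives nonvanishing at some `t / 2 ^ n`, and `n` doublings reach `t`.
-/
lemma IsInfinitelyDivisible.charFun_ne_zero {μ : ProbabilityMeasure 𝔼}
    (h : IsInfinitelyDivisible μ) (t : 𝔼) : charFun (μ : Measure 𝔼) t ≠ 0 := by
  rw [isInfinitelyDivisible_iff] at h
  have step (s : 𝔼) (hs : charFun (μ : Measure 𝔼) s ≠ 0) :
      charFun (μ : Measure 𝔼) ((2 : ℝ) • s) ≠ 0 := by
    intro h0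
    have hpos : 0 < ‖charFun (μ : Measure 𝔼) s‖ := norm_pos_iff.mpr hs
    -- A zero at `2s` is a zero of every root `ν`, so doubling gives `1 ≤ 4 (1 - ‖charFun ν s‖ ^
    -- 2)`. This is the source of `3 / 4`, and the `n`-th power contradicts a fixed nonzero value at
    -- `s`.
    have hlim : Tendsto (fun n : ℕ ↦ (3 / 4 : ℝ) ^ n) atTop (𝓝 0) :=
      tendsto_pow_atTop_nhds_zero_of_lt_one (by norm_num) (by norm_num)
    obtain ⟨n, hn, hn1⟩ := ((hlim.eventually_lt_const (pow_pos hpos 2)).and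
      (eventually_ge_atTop 1)).exists
    obtain ⟨ν, hν⟩ := h n hn1
    have hν0 : charFun (ν : Measure 𝔼) ((2 : ℝ) • s) = 0 := by
      have := hν ((2 : ℝ) • s)
      rw [h0] at this
      exact eq_zero_of_pow_eq_zero this
    have hle := one_sub_normSq_charFun_two_smul_le (ν : Measure 𝔼) s
    rw [hν0] at hle
    have hle' : ‖charFun (ν : Measure 𝔼) s‖ ^ 2 ≤ 3 / 4 := by
      simp only [norm_zero] at hle
      linarith
    have := pow_le_pow_left₀ (by positivity) hle' n
    rw [← pow_mul, mul_comm, pow_mul, ← norm_pow, hν] at this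
    linarith
  have hlim : Tendsto (fun n : ℕ ↦ ((1 / 2 : ℝ) ^ n) • t) atTop (𝓝 0) := by
    simpa using (tendsto_pow_atTop_nhds_zero_of_lt_one (r := (1 / 2 : ℝ)) (by norm_num)
      (by norm_num)).smul_const t
  have hc : Tendsto (fun n : ℕ ↦ charFun (μ : Measure 𝔼) (((1 / 2 : ℝ) ^ n) • t)) atTop (𝓝 1) := by
    have := ((continuous_charFun (μ : Measure 𝔼)).tendsto 0).comp hlim
    simpa [Function.comp_def] using this
  obtain ⟨n, hn⟩ := (hc.eventually_ne one_ne_zero).exists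
  have key (k : ℕ) : charFun (μ : Measure 𝔼) ((2 : ℝ) ^ k • ((1 / 2 : ℝ) ^ n) • t) ≠ 0 := by
    induction k with
    | zero => simpa using hn
    | succ k ih => rw [pow_succ', mul_smul]; exact step _ ih
  have := key n
  rwa [smul_smul, ← mul_pow, show (2 : ℝ) * (1 / 2) = 1 by norm_num, one_pow, one_smul] at this

lemma exists_isInfinitelyDivisible_dirac (b : 𝔼) : ∃ μ : ProbabilityMeasure 𝔼,
    IsInfinitelyDivisible μ ∧
      ∀ t, charFun (μ : Measure 𝔼) t = Complex.exp ((inner ℝ b t : ℝ) * Complex.I) := by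
  refine ⟨⟨Measure.dirac b, inferInstance⟩, ?_, fun t ↦ charFun_dirac t⟩
  refine isInfinitelyDivisible_iff.mpr fun n hn ↦
    ⟨⟨Measure.dirac ((n : ℝ)⁻¹ • b), inferInstance⟩, fun t ↦ ?_⟩
  have hn' : (n : ℂ) ≠ 0 := by exact_mod_cast (by omega : n ≠ 0)
  simp only [ProbabilityMeasure.coe_mk, charFun_dirac, ← Complex.exp_nat_mul,
    real_inner_smul_left]
  congr 1
  push_cast
  field_simp

lemma exists_isInfinitelyDivisible_conv {μ₁ μ₂ : ProbabilityMeasure 𝔼}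
    (h₁ : IsInfinitelyDivisible μ₁) (h₂ : IsInfinitelyDivisible μ₂) :
    ∃ μ : ProbabilityMeasure 𝔼, IsInfinitelyDivisible μ ∧
      ∀ t, charFun (μ : Measure 𝔼) t
        = charFun (μ₁ : Measure 𝔼) t * charFun (μ₂ : Measure 𝔼) t := by
  refine ⟨⟨Measure.conv (μ₁ : Measure 𝔼) μ₂, inferInstance⟩, ?_, fun t ↦ charFun_conv t⟩
  refine isInfinitelyDivisible_iff.mpr fun n hn ↦ ?_
  obtain ⟨ν₁, hν₁⟩ := isInfinitelyDivisible_iff.mp h₁ n hn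
  obtain ⟨ν₂, hν₂⟩ := isInfinitelyDivisible_iff.mp h₂ n hn
  refine ⟨⟨Measure.conv (ν₁ : Measure 𝔼) ν₂, inferInstance⟩, fun t ↦ ?_⟩
  simp only [ProbabilityMeasure.coe_mk, charFun_conv, mul_pow, hν₁, hν₂]

/-- The `n`-th convolution root is the compound Poisson law with Lévy measure `ν / n`. -/
lemma exists_isInfinitelyDivisible_compoundPoisson (ν : Measure 𝔼) [IsFiniteMeasure ν] :
    ∃ μ : ProbabilityMeasure 𝔼, IsInfinitelyDivisible μ ∧
      ∀ t, charFun (μ : Measure 𝔼) t = Complex.exp (charFun ν t - ν.real Set.univ) := by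
  obtain ⟨μ, hμ⟩ := exists_compoundPoisson ν
  refine ⟨μ, isInfinitelyDivisible_iff.mpr fun n hn ↦ ?_, hμ⟩
  have hn' : (n : ℂ) ≠ 0 := by exact_mod_cast (by omega : n ≠ 0)
  have : IsFiniteMeasure ((n : ENNReal)⁻¹ • ν) :=
    Measure.smul_finite _ (ENNReal.inv_ne_top.mpr (by exact_mod_cast (by omega : n ≠ 0)))
  obtain ⟨ρ, hρ⟩ := exists_compoundPoisson ((n : ENNReal)⁻¹ • ν)
  refine ⟨ρ, fun t ↦ ?_⟩
  rw [hρ, hμ, ← Complex.exp_nat_mul, charFun_smul_measure]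
  congr 1
  simp
  field_simp

end InfinitelyDivisible

/-! ### Lévy exponents with complex jump intensities -/

section LevyExponent

variable {E : Type*} [NormedAddCommGroup E] [InnerProductSpace ℝ E]

/-- The Lévy exponent `t ↦ ∑ aₙ (exp (i ⟨xₙ, t⟩) - 1)` with complex jump intensities `aₙ`. -/
noncomputable def levyExponent (a : ℕ → ℂ) (x : ℕ → E) (t : E) : ℂ :=
  ∑' n, a n * (Complex.exp ((inner ℝ (x n) t : ℝ) * Complex.I) - 1)

lemma norm_levyExponent_term_le (a : ℕ → ℂ) (x : ℕ → E) (t : E) (n : ℕ) :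
    ‖a n * (Complex.exp ((inner ℝ (x n) t : ℝ) * Complex.I) - 1)‖ ≤ ‖a n‖ * 2 := by
  rw [norm_mul]
  gcongr
  refine (norm_sub_le _ _).trans ?_
  rw [Complex.norm_exp_ofReal_mul_I, norm_one]
  norm_num

lemma hasSum_levyExponent {a : ℕ → ℂ} (ha : Summable fun n ↦ ‖a n‖) (x : ℕ → E) (t : E) :
    HasSum (fun n ↦ a n * (Complex.exp ((inner ℝ (x n) t : ℝ) * Complex.I) - 1))
      (levyExponent a x t) :=
  (Summable.of_norm_bounded (ha.mul_right 2) (norm_levyExponent_term_le a x t)).hasSum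

lemma continuous_levyExponent {a : ℕ → ℂ} (ha : Summable fun n ↦ ‖a n‖) (x : ℕ → E) :
    Continuous (levyExponent a x) :=
  continuous_tsum (fun n ↦ by fun_prop) (ha.mul_right 2)
    fun n t ↦ norm_levyExponent_term_le a x t n

@[simp]
lemma levyExponent_zero (a : ℕ → ℂ) (x : ℕ → E) : levyExponent a x 0 = 0 := by
  simp [levyExponent]

/-- The operation `φ ↦ conj φ(-·)`, which fixes characteristic functions, conjugates the intensities
and leaves the jumps alone. -/
lemma conj_levyExponent_neg (a : ℕ → ℂ) (x : ℕ → E) (t : E) :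
    (starRingEnd ℂ) (levyExponent a x (-t))
      = levyExponent (fun n ↦ (starRingEnd ℂ) (a n)) x t := by
  rw [levyExponent, Complex.conj_tsum]
  refine tsum_congr fun n ↦ ?_
  simp [← Complex.exp_conj]

lemma levyExponent_add_conj {a : ℕ → ℂ} (ha : Summable fun n ↦ ‖a n‖) (x : ℕ → E) (t : E) :
    levyExponent a x t + levyExponent (fun n ↦ (starRingEnd ℂ) (a n)) x t
      = 2 * levyExponent (fun n ↦ ((a n).re : ℂ)) x t := by
  have h1 := hasSum_levyExponent ha x t
  have h2 := hasSum_levyExponent (a := fun n ↦ (starRingEnd ℂ) (a n)) (by simpa using ha) x t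
  have h3 := hasSum_levyExponent (a := fun n ↦ ((a n).re : ℂ))
    (ha.of_nonneg_of_le (fun _ ↦ norm_nonneg _)
      (fun n ↦ by simpa using Complex.abs_re_le_norm (a n))) x t
  refine (h1.add h2).unique ((h3.mul_left 2).congr_fun fun n ↦ ?_)
  rw [← add_mul, Complex.add_conj]
  push_cast
  ring

end LevyExponent

/-! ### Signed atomic Lévy measures give quotients -/

section QuasiInfinitelyDivisible

variable {d : ℕ}

local notation "𝔼" => EuclideanSpace ℝ (Fin d)

/-- A function is a quotient of characteristic functions of infinitely divisible distributions. -/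
def IsInfinitelyDivisibleQuotient (φ : 𝔼 → ℂ) : Prop :=
  ∃ μ₁ μ₂ : ProbabilityMeasure 𝔼, IsInfinitelyDivisible μ₁ ∧ IsInfinitelyDivisible μ₂ ∧
    ∀ t, φ t = charFun (μ₁ : Measure 𝔼) t / charFun (μ₂ : Measure 𝔼) t

lemma IsInfinitelyDivisibleQuotient.mul {φ ψ : 𝔼 → ℂ} (hφ : IsInfinitelyDivisibleQuotient φ)
    (hψ : IsInfinitelyDivisibleQuotient ψ) :
    IsInfinitelyDivisibleQuotient fun t ↦ φ t * ψ t := by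
  obtain ⟨μ₁, μ₂, h₁, h₂, hφ⟩ := hφ
  obtain ⟨ν₁, ν₂, k₁, k₂, hψ⟩ := hψ
  obtain ⟨ρ₁, l₁, e₁⟩ := exists_isInfinitelyDivisible_conv h₁ k₁
  obtain ⟨ρ₂, l₂, e₂⟩ := exists_isInfinitelyDivisible_conv h₂ k₂
  exact ⟨ρ₁, ρ₂, l₁, l₂, fun t ↦ by simp only [hφ, hψ, e₁, e₂, div_mul_div_comm]⟩

lemma isInfinitelyDivisibleQuotient_exp_inner (b : 𝔼) :
    IsInfinitelyDivisibleQuotient fun t : 𝔼 ↦ Complex.exp ((inner ℝ b t : ℝ) * Complex.I) := by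
  obtain ⟨μ, h, e⟩ := exists_isInfinitelyDivisible_dirac b
  obtain ⟨ν, k, f⟩ := exists_isInfinitelyDivisible_dirac (0 : 𝔼)
  exact ⟨μ, ν, h, k, fun t ↦ by simp [e, f]⟩

lemma exists_isInfinitelyDivisible_exp_levyExponent {c : ℕ → ℝ} (hc : Summable c)
    (h0 : ∀ n, 0 ≤ c n) (x : ℕ → 𝔼) : ∃ μ : ProbabilityMeasure 𝔼, IsInfinitelyDivisible μ ∧
      ∀ t, charFun (μ : Measure 𝔼) t = Complex.exp (levyExponent (fun n ↦ (c n : ℂ)) x t) := by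
  let ν : Measure 𝔼 := Measure.sum fun n ↦ ENNReal.ofReal (c n) • Measure.dirac (x n)
  have : IsFiniteMeasure ν := by
    constructor
    rw [Measure.sum_apply _ MeasurableSet.univ]
    simp [← ENNReal.ofReal_tsum_of_nonneg h0 hc]
  have hν (t : 𝔼) : HasSum (fun n ↦ (c n : ℂ) * Complex.exp ((inner ℝ (x n) t : ℝ) * Complex.I))
      (charFun ν t) := by
    have := hasSum_charFun_sum (fun n ↦ ENNReal.ofReal (c n) • Measure.dirac (x n)) t
    simpa only [charFun_smul_measure, charFun_dirac, ENNReal.toReal_ofReal (h0 _)] using this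
  obtain ⟨μ, h, e⟩ := exists_isInfinitelyDivisible_compoundPoisson ν
  refine ⟨μ, h, fun t ↦ ?_⟩
  rw [e]
  congr 1
  -- The value at `0` is the total mass, which supplies the `- 1` in each term of the exponent.
  have h1 := (hν t).sub (hν 0)
  rw [charFun_zero] at h1
  refine h1.unique ((hasSum_levyExponent (a := fun n ↦ (c n : ℂ)) (by simpa using hc.abs)
    x t).congr_fun fun n ↦ ?_)
  simp
  ring

/-- Positive parts of the intensities form the numerator, negative parts the denominator. -/
lemma isInfinitelyDivisibleQuotient_exp_levyExponent {c : ℕ → ℝ} (hc : Summable c)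
    (x : ℕ → 𝔼) : IsInfinitelyDivisibleQuotient fun t : 𝔼 ↦
      Complex.exp (levyExponent (fun n ↦ (c n : ℂ)) x t) := by
  have hp : Summable fun n ↦ (c n)⁺ :=
    hc.abs.of_nonneg_of_le (fun n ↦ posPart_nonneg _) fun n ↦
      ((posPart_add_negPart (c n)).symm ▸ le_add_of_nonneg_right (negPart_nonneg _) :
        (c n)⁺ ≤ |c n|)
  have hm : Summable fun n ↦ (c n)⁻ :=
    hc.abs.of_nonneg_of_le (fun n ↦ negPart_nonneg _) fun n ↦
      ((posPart_add_negPart (c n)).symm ▸ le_add_of_nonneg_left (posPart_nonneg _) :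
        (c n)⁻ ≤ |c n|)
  obtain ⟨μ, h, e⟩ := exists_isInfinitelyDivisible_exp_levyExponent hp
    (fun n ↦ posPart_nonneg _) x
  obtain ⟨ν, k, f⟩ := exists_isInfinitelyDivisible_exp_levyExponent hm
    (fun n ↦ negPart_nonneg _) x
  refine ⟨μ, ν, h, k, fun t ↦ ?_⟩
  rw [e, f, ← Complex.exp_sub]
  refine congrArg Complex.exp ?_
  have h1 := hasSum_levyExponent (a := fun n ↦ (((c n)⁺ : ℝ) : ℂ)) (by simpa using hp.abs) x t
  have h2 := hasSum_levyExponent (a := fun n ↦ (((c n)⁻ : ℝ) : ℂ)) (by simpa using hm.abs) x t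
  have h3 := hasSum_levyExponent (a := fun n ↦ (c n : ℂ)) (by simpa using hc.abs) x t
  refine h3.unique ((h1.sub h2).congr_fun fun n ↦ ?_)
  rw [← sub_mul, ← Complex.ofReal_sub, posPart_sub_negPart]

end QuasiInfinitelyDivisible

/-! ### Logarithms of polynomials without zeros on the unit circle -/

section Polynomial

open Polynomial

/-- On the unit circle, `f` is a monomial times the exponential of an absolutely convergent
Fourier series. -/
def HasExpFourierSeries (f : ℂ → ℂ) : Prop :=
  ∃ (N : ℕ) (C : ℂ) (a b : ℕ → ℂ), Summable (fun n ↦ ‖a n‖) ∧ Summable (fun n ↦ ‖b n‖) ∧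
    ∀ z, ‖z‖ = 1 → f z = C * z ^ N * Complex.exp (∑' n, a n * z ^ n + ∑' n, b n * z⁻¹ ^ n)

lemma summable_mul_pow_of_norm_eq_one {a : ℕ → ℂ} (ha : Summable fun n ↦ ‖a n‖) {z : ℂ}
    (hz : ‖z‖ = 1) : Summable fun n ↦ a n * z ^ n :=
  Summable.of_norm (by simpa [hz] using ha)

lemma hasExpFourierSeries_const (C : ℂ) : HasExpFourierSeries fun _ ↦ C :=
  ⟨0, C, 0, 0, by simp, by simp, by simp⟩

lemma HasExpFourierSeries.mul {f g : ℂ → ℂ} (hf : HasExpFourierSeries f)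
    (hg : HasExpFourierSeries g) : HasExpFourierSeries fun z ↦ f z * g z := by
  obtain ⟨N, C, a, b, ha, hb, hf⟩ := hf
  obtain ⟨M, D, a', b', ha', hb', hg⟩ := hg
  refine ⟨N + M, C * D, a + a', b + b', (ha.add ha').of_nonneg_of_le (fun _ ↦ norm_nonneg _)
    (fun n ↦ norm_add_le _ _), (hb.add hb').of_nonneg_of_le (fun _ ↦ norm_nonneg _)
    (fun n ↦ norm_add_le _ _), fun z hz ↦ ?_⟩
  have hz' : ‖z⁻¹‖ = 1 := by simp [hz]
  simp only [Pi.add_apply, add_mul]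
  rw [hf z hz, hg z hz,
    (summable_mul_pow_of_norm_eq_one ha hz).tsum_add (summable_mul_pow_of_norm_eq_one ha' hz),
    (summable_mul_pow_of_norm_eq_one hb hz').tsum_add (summable_mul_pow_of_norm_eq_one hb' hz'),
    add_add_add_comm, Complex.exp_add _ (_ + _), pow_add]
  ring

/-- Taylor series of `log (1 - wz)`. The `n = 0` term is harmless, since division by zero makes it
`0`. -/
lemma one_sub_mul_eq_exp {w z : ℂ} (hw : ‖w‖ < 1) (hz : ‖z‖ = 1) :
    1 - w * z = Complex.exp (∑' n : ℕ, -(w ^ n / n) * z ^ n) := by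
  have hwz : ‖w * z‖ < 1 := by rwa [norm_mul, hz, mul_one]
  have h := (Complex.hasSum_taylorSeries_neg_log hwz).neg
  rw [neg_neg] at h
  rw [← Complex.exp_log (x := 1 - w * z), ← h.tsum_eq]
  · congr 1
    refine tsum_congr fun n ↦ ?_
    rw [mul_pow]
    ring
  · intro h0
    rw [← sub_eq_zero.mp h0] at hwz
    simp at hwz

lemma summable_norm_neg_pow_div {w : ℂ} (hw : ‖w‖ < 1) :
    Summable fun n : ℕ ↦ ‖-(w ^ n / n)‖ := by
  refine (summable_geometric_of_lt_one (norm_nonneg w) hw).of_nonneg_of_le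
    (fun _ ↦ norm_nonneg _) fun n ↦ ?_
  rw [norm_neg, norm_div, norm_pow, Complex.norm_natCast]
  rcases Nat.eq_zero_or_pos n with rfl | hn
  · simp
  · exact div_le_self (by positivity) (by exact_mod_cast hn)

/-- A root inside the disc is handled by `z - α = z (1 - α z⁻¹)`, a root outside by `z - α = -α (1 -
α⁻¹ z)`; the remaining factor then has a convergent logarithm. -/
lemma hasExpFourierSeries_sub {α : ℂ} (hα : ‖α‖ ≠ 1) : HasExpFourierSeries fun z ↦ z - α := by
  rcases lt_or_gt_of_ne hα with h | h
  · refine ⟨1, 1, 0, fun n ↦ -(α ^ n / n), by simp,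
      summable_norm_neg_pow_div h, fun z hz ↦ ?_⟩
    have hz0 : z ≠ 0 := by rintro rfl; simp at hz
    simp only [Pi.zero_apply, zero_mul, tsum_zero, zero_add]
    rw [← one_sub_mul_eq_exp h (z := z⁻¹) (by simp [hz])]
    field_simp
  · have hα0 : α ≠ 0 := by rintro rfl; simp at h; linarith
    have hw : ‖α⁻¹‖ < 1 := by rw [norm_inv]; exact inv_lt_one_of_one_lt₀ h
    refine ⟨0, -α, fun n ↦ -(α⁻¹ ^ n / n), 0, summable_norm_neg_pow_div hw,
      by simp, fun z hz ↦ ?_⟩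
    simp only [Pi.zero_apply, zero_mul, tsum_zero, add_zero]
    rw [← one_sub_mul_eq_exp hw hz]
    field_simp
    ring

lemma hasExpFourierSeries_eval {p : ℂ[X]} (hp : ∀ z, ‖z‖ = 1 → p.eval z ≠ 0) :
    HasExpFourierSeries fun z ↦ p.eval z := by
  have hroots (s : Multiset ℂ) (hs : ∀ α ∈ s, ‖α‖ ≠ 1) :
      HasExpFourierSeries fun z ↦ ((s.map fun α ↦ X - C α).prod).eval z := by
    induction s using Multiset.induction_on with
    | empty => simpa using hasExpFourierSeries_const 1
    | cons α s ih =>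
      simp only [Multiset.map_cons, Multiset.prod_cons, eval_mul, eval_sub, eval_X, eval_C]
      exact (hasExpFourierSeries_sub (hs α (Multiset.mem_cons_self α s))).mul
        (ih fun β hβ ↦ hs β (Multiset.mem_cons_of_mem hβ))
  have h := (hasExpFourierSeries_const p.leadingCoeff).mul
    (hroots p.roots fun α hα h1 ↦ hp α h1 (isRoot_of_mem_roots hα))
  have hsplit : p = C p.leadingCoeff * (p.roots.map fun α ↦ X - C α).prod :=
    (IsAlgClosed.splits p).eq_prod_roots
  convert h using 2 with z
  conv_lhs => rw [hsplit, eval_mul, eval_C]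

end Polynomial

/-! ### Zero-free lattice laws are quasi-infinitely divisible -/

section PolynomialCharFun

variable {d : ℕ}

local notation "𝔼" => EuclideanSpace ℝ (Fin d)

lemma tsum_mul_exp_inner_pow {E : Type*} [NormedAddCommGroup E] [InnerProductSpace ℝ E]
    {a : ℕ → ℂ} (ha : Summable fun n ↦ ‖a n‖) (h t : E) :
    ∑' n, a n * Complex.exp ((inner ℝ h t : ℝ) * Complex.I) ^ n
      = levyExponent a (fun n ↦ (n : ℝ) • h) t + ∑' n, a n := by
  rw [levyExponent, ← Summable.tsum_add (hasSum_levyExponent ha _ t).summable ha.of_norm]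
  refine tsum_congr fun n ↦ ?_
  rw [← Complex.exp_nat_mul, real_inner_smul_left]
  push_cast
  ring_nf

open Polynomial in
-- The Fourier expansion writes the characteristic function as a phase times the exponential of a
-- Lévy exponent, but with intensities that are a priori complex. Averaging with the conjugate
-- representation makes them real.
lemma isQuasiInfinitelyDivisible_of_charFun_eq_eval {μ : ProbabilityMeasure 𝔼} {p : ℂ[X]}
    (hp : ∀ z, ‖z‖ = 1 → p.eval z ≠ 0) (x₀ h : 𝔼)
    (hμ : ∀ t, charFun (μ : Measure 𝔼) t = Complex.exp ((inner ℝ x₀ t : ℝ) * Complex.I) *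
      p.eval (Complex.exp ((inner ℝ h t : ℝ) * Complex.I))) :
    IsQuasiInfinitelyDivisible μ := by
  obtain ⟨N, C, a, b, ha, hb, hf⟩ := hasExpFourierSeries_eval hp
  set x : ℕ → 𝔼 := fun n ↦ (n : ℝ) • h
  set y : ℕ → 𝔼 := fun n ↦ (n : ℝ) • (-h)
  set e : 𝔼 → ℂ := fun t ↦ Complex.exp ((inner ℝ (x₀ + (N : ℝ) • h) t : ℝ) * Complex.I) with he
  set φ : 𝔼 → ℂ := charFun (μ : Measure 𝔼) with hφ
  have hee (t : 𝔼) : (starRingEnd ℂ) (e (-t)) = e t := by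
    simp [he, ← Complex.exp_conj]
  have h1 (t : 𝔼) : φ t = C * Complex.exp (∑' n, a n + ∑' n, b n) *
      (e t * Complex.exp (levyExponent a x t + levyExponent b y t)) := by
    have hinv : (Complex.exp ((inner ℝ h t : ℝ) * Complex.I))⁻¹
        = Complex.exp ((inner ℝ (-h) t : ℝ) * Complex.I) := by
      rw [← Complex.exp_neg, inner_neg_left]
      push_cast
      ring_nf
    rw [hμ, show p.eval _ = _ from hf _ (Complex.norm_exp_ofReal_mul_I _), hinv, tsum_mul_exp_inner_pow ha,
      tsum_mul_exp_inner_pow hb, add_add_add_comm, Complex.exp_add (_ + _), he,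
      ← Complex.exp_nat_mul]
    simp only [inner_add_left, real_inner_smul_left, Complex.ofReal_add, Complex.ofReal_mul,
      Complex.ofReal_natCast, add_mul, Complex.exp_add, mul_assoc]
    ring
  -- Normalisation at `t = 0` fixes the constant.
  have hC : C * Complex.exp (∑' n, a n + ∑' n, b n) = 1 := by
    have := h1 0
    simpa [hφ, he] using this.symm
  simp only [hC, one_mul] at h1
  have h2 (t : 𝔼) : φ t = e t * Complex.exp (levyExponent (fun n ↦ (starRingEnd ℂ) (a n)) x t
      + levyExponent (fun n ↦ (starRingEnd ℂ) (b n)) y t) := by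
    have := congrArg (starRingEnd ℂ) (h1 (-t))
    rwa [hφ, charFun_neg, Complex.conj_conj, map_mul, hee, ← Complex.exp_conj, map_add,
      conj_levyExponent_neg, conj_levyExponent_neg] at this
  have hre {c : ℕ → ℂ} (hc : Summable fun n ↦ ‖c n‖) : Summable fun n ↦ (c n).re :=
    (hc.of_nonneg_of_le (fun _ ↦ abs_nonneg _) fun n ↦ Complex.abs_re_le_norm (c n)).of_abs
  have hre' {c : ℕ → ℂ} (hc : Summable fun n ↦ ‖c n‖) : Summable fun n ↦ ‖((c n).re : ℂ)‖ := by
    simpa using (hre hc).abs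
  set ψ : 𝔼 → ℂ := fun t ↦ e t * Complex.exp (levyExponent (fun n ↦ ((a n).re : ℂ)) x t) *
    Complex.exp (levyExponent (fun n ↦ ((b n).re : ℂ)) y t) with hψ
  -- Multiplying the representations with intensities `a, b` and with their conjugates doubles the
  -- real parts, so only the sign of the square root is left open.
  have hsq (t : 𝔼) : φ t ^ 2 = ψ t ^ 2 := by
    have : φ t ^ 2 = e t ^ 2 * Complex.exp (2 * levyExponent (fun n ↦ ((a n).re : ℂ)) x t
        + 2 * levyExponent (fun n ↦ ((b n).re : ℂ)) y t) := by
      rw [← levyExponent_add_conj ha, ← levyExponent_add_conj hb, sq]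
      nth_rewrite 1 [h1]
      rw [h2, add_add_add_comm, Complex.exp_add (_ + _)]
      ring
    rw [this, Complex.exp_add, two_mul, two_mul, Complex.exp_add, Complex.exp_add, hψ]
    ring
  have hψc : Continuous ψ := by
    have := continuous_levyExponent (hre' ha) x
    have := continuous_levyExponent (hre' hb) y
    fun_prop
  -- `ψ` is zero-free and the space is connected, so agreement at `0` settles the sign everywhere.
  have heq : Set.EqOn φ ψ Set.univ :=
    isPreconnected_univ.eq_of_sq_eq (continuous_charFun _).continuousOn hψc.continuousOn
      (fun t _ ↦ hsq t)
      (fun _ ↦ mul_ne_zero (mul_ne_zero (Complex.exp_ne_zero _) (Complex.exp_ne_zero _))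
        (Complex.exp_ne_zero _)) (Set.mem_univ 0) (by simp [hφ, hψ, he])
  have hq : IsInfinitelyDivisibleQuotient ψ :=
    ((isInfinitelyDivisibleQuotient_exp_inner _).mul
      (isInfinitelyDivisibleQuotient_exp_levyExponent (hre ha) x)).mul
      (isInfinitelyDivisibleQuotient_exp_levyExponent (hre hb) y)
  rwa [← show φ = ψ from funext fun t ↦ heq (Set.mem_univ t)] at hq

end PolynomialCharFun

/-! ### Tilting lattice laws -/

section Lattice

variable {d : ℕ}

local notation "𝔼" => EuclideanSpace ℝ (Fin d)

lemma exists_charFun_eq_lattice {m : ℕ} {w : ℕ → ℝ} (hw : ∀ k, 0 ≤ w k)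
    (hsum : ∑ k ∈ Finset.range m, w k = 1) (x₀ h : 𝔼) : ∃ μ : ProbabilityMeasure 𝔼,
      ∀ t, charFun (μ : Measure 𝔼) t = Complex.exp ((inner ℝ x₀ t : ℝ) * Complex.I) *
        ∑ k ∈ Finset.range m, (w k : ℂ) * Complex.exp ((inner ℝ h t : ℝ) * Complex.I) ^ k := by
  obtain ⟨μ, hμ⟩ := exists_charFun_eq_sum (Finset.range m) hw hsum fun k ↦ x₀ + (k : ℝ) • h
  refine ⟨μ, fun t ↦ ?_⟩
  rw [hμ, Finset.mul_sum]
  refine Finset.sum_congr rfl fun k _ ↦ ?_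
  rw [← Complex.exp_nat_mul, mul_left_comm, ← Complex.exp_add, inner_add_left,
    real_inner_smul_left]
  push_cast
  ring_nf

open Polynomial in
-- The roots have finitely many moduli. Modulus `1` itself may occur, hence the one-sided
-- neighbourhood.
lemma eventually_eval_mul_ne_zero {p : ℂ[X]} (hp : p ≠ 0) :
    ∀ᶠ r : ℝ in 𝓝[>] 1, ∀ z : ℂ, ‖z‖ = 1 → p.eval (r * z) ≠ 0 := by
  have hfin : ({r : ℝ | ∃ α ∈ p.roots, ‖α‖ = r} \ {1}).Finite := by
    refine Set.Finite.sdiff (((p.roots.toFinset.image fun α ↦ ‖α‖).finite_toSet).subset ?_)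
    rintro r ⟨α, hα, rfl⟩
    simp only [Finset.coe_image, Set.mem_image, Finset.mem_coe, Multiset.mem_toFinset]
    exact ⟨α, hα, rfl⟩
  have hnhds : ({r : ℝ | ∃ α ∈ p.roots, ‖α‖ = r} \ {1})ᶜ ∈ 𝓝 (1 : ℝ) :=
    hfin.isClosed.isOpen_compl.mem_nhds (by simp)
  filter_upwards [mem_nhdsWithin_of_mem_nhds hnhds, self_mem_nhdsWithin] with r hr hr1 z hz h0
  refine hr ⟨⟨r * z, (mem_roots hp).mpr h0, ?_⟩, ne_of_gt hr1⟩
  rw [norm_mul, hz, mul_one, Complex.norm_real, Real.norm_of_nonneg]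
  exact zero_le_one.trans (le_of_lt hr1)

open Polynomial in
/-- Exponential tilting: finitely supported lattice distributions are weak limits of
quasi-infinitely divisible distributions. -/
lemma mem_closure_isQuasiInfinitelyDivisible_of_lattice {m : ℕ} {w : ℕ → ℝ} (hw : ∀ k, 0 ≤ w k)
    (hsum : ∑ k ∈ Finset.range m, w k = 1) {x₀ h : 𝔼} {μ : ProbabilityMeasure 𝔼}
    (hμ : ∀ t, charFun (μ : Measure 𝔼) t = Complex.exp ((inner ℝ x₀ t : ℝ) * Complex.I) *
        ∑ k ∈ Finset.range m, (w k : ℂ) * Complex.exp ((inner ℝ h t : ℝ) * Complex.I) ^ k) :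
    μ ∈ closure {μ : ProbabilityMeasure 𝔼 | IsQuasiInfinitelyDivisible μ} := by
  let p : ℂ[X] := ∑ k ∈ Finset.range m, C (w k : ℂ) * X ^ k
  have hpe (z : ℂ) : p.eval z = ∑ k ∈ Finset.range m, (w k : ℂ) * z ^ k := by
    simp [p, eval_finsetSum]
  have hp : p ≠ 0 := by
    intro h0
    have := hpe 1
    simp only [h0, eval_zero, one_pow, mul_one] at this
    rw [← Complex.ofReal_sum, hsum] at this
    simp at this
  -- `S r` normalises the tilted weights `w k * r ^ k`; their generating polynomial is `p(rz) / S
  -- r`, whose roots are those of `p` divided by `r`.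
  let S : ℝ → ℝ := fun r ↦ ∑ k ∈ Finset.range m, w k * r ^ k
  have hS1 : S 1 = 1 := by simpa [S] using hsum
  have hSc : Continuous S := by fun_prop
  have hS {r : ℝ} (hr : 1 ≤ r) : 1 ≤ S r := by
    rw [← hsum]
    exact Finset.sum_le_sum fun k _ ↦ le_mul_of_one_le_right (hw k) (one_le_pow₀ hr)
  let r : ℕ → ℝ := fun n ↦ 1 + 1 / ((n : ℝ) + 1)
  have hr1 (n : ℕ) : 1 < r n := by
    have : 0 < 1 / ((n : ℝ) + 1) := by positivity
    linarith
  have hr0 : Tendsto r atTop (𝓝 1) := by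
    simpa [r] using tendsto_one_div_add_atTop_nhds_zero_nat.const_add (1 : ℝ)
  have hr : Tendsto r atTop (𝓝[>] 1) :=
    tendsto_nhdsWithin_iff.mpr ⟨hr0, Eventually.of_forall hr1⟩
  have hSpos (n : ℕ) : 0 < S (r n) := zero_lt_one.trans_le (hS (hr1 n).le)
  have hex (n : ℕ) := exists_charFun_eq_lattice (m := m) (w := fun k ↦ w k * r n ^ k / S (r n))
    (fun k ↦ div_nonneg (mul_nonneg (hw k) (pow_nonneg (zero_le_one.trans (hr1 n).le) k))
      (hSpos n).le)
    (by rw [← Finset.sum_div]; exact div_self (hSpos n).ne') x₀ h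
  choose ν hν using hex
  have hν' (n : ℕ) (t : 𝔼) : charFun (ν n : Measure 𝔼) t =
      Complex.exp ((inner ℝ x₀ t : ℝ) * Complex.I) *
        (((S (r n) : ℂ))⁻¹ *
          p.eval (r n * Complex.exp ((inner ℝ h t : ℝ) * Complex.I))) := by
    rw [hν, hpe, Finset.mul_sum _ _ ((S (r n) : ℂ))⁻¹]
    congr 1
    refine Finset.sum_congr rfl fun k _ ↦ ?_
    push_cast
    ring
  refine mem_closure_of_tendsto (b := atTop) (f := ν)
    (ProbabilityMeasure.tendsto_of_tendsto_charFun fun t ↦ ?_) ?_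
  · simp only [hν']
    have h1 : Tendsto (fun n ↦ ((S (r n) : ℂ))⁻¹) atTop (𝓝 1) := by
      have := (hSc.tendsto 1).comp hr0
      rw [hS1] at this
      simpa using ((Complex.continuous_ofReal.tendsto 1).comp this).inv₀ (by simp)
    have h2 : Tendsto (fun n ↦ p.eval (r n * Complex.exp ((inner ℝ h t : ℝ) * Complex.I)))
        atTop (𝓝 (p.eval (Complex.exp ((inner ℝ h t : ℝ) * Complex.I)))) := by
      refine (p.continuous.tendsto _).comp ?_
      simpa using ((Complex.continuous_ofReal.tendsto 1).comp hr0).mul_const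
        (Complex.exp ((inner ℝ h t : ℝ) * Complex.I))
    rw [hμ, ← hpe]
    simpa using (h1.mul h2).const_mul (Complex.exp ((inner ℝ x₀ t : ℝ) * Complex.I))
  · filter_upwards [hr.eventually (eventually_eval_mul_ne_zero hp)] with n hn
    refine isQuasiInfinitelyDivisible_of_charFun_eq_eval
      (p := C ((S (r n) : ℂ))⁻¹ * p.comp (C (r n : ℂ) * X)) (fun z hz ↦ ?_) x₀ h fun t ↦ ?_
    · simpa [(hSpos n).ne'] using hn z hz
    · rw [hν']
      simp

end Lattice

/-! ### Density on the line -/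

section Line

/-- Turns expectations under the discretised law into integrals over the original one, where
dominated convergence applies. -/
lemma sum_measureReal_preimage_mul {Ω : Type*} [MeasurableSpace Ω] (μ : Measure Ω)
    [IsFiniteMeasure μ] {K : Ω → ℕ} (hK : Measurable K) {m : ℕ} (hm : ∀ ω, K ω < m)
    (g : ℕ → ℂ) :
    ∑ k ∈ Finset.range m, (μ.real (K ⁻¹' {k}) : ℂ) * g k = ∫ ω, g (K ω) ∂μ := by
  have hg (ω : Ω) : g (K ω)
      = ∑ k ∈ Finset.range m, (K ⁻¹' {k}).indicator (fun _ ↦ g k) ω := by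
    rw [Finset.sum_eq_single (K ω)]
    · simp
    · intro k _ hk
      simp [hk.symm]
    · intro h
      exact absurd (Finset.mem_range.mpr (hm ω)) h
  have hmeas (k : ℕ) : MeasurableSet (K ⁻¹' {k}) := hK (measurableSet_singleton k)
  simp_rw [hg]
  rw [integral_finsetSum _ fun k _ ↦ (integrable_const _).indicator (hmeas k)]
  refine Finset.sum_congr rfl fun k _ ↦ ?_
  rw [integral_indicator_const _ (hmeas k), Complex.real_smul]

local notation "𝔼₁" => EuclideanSpace ℝ (Fin 1)

/-- The index of the grid point of `{-n, -n + 1 / n, …, n}` nearest to `y` from below. -/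
noncomputable def gridIndex (n : ℕ) (y : ℝ) : ℕ := min ⌊(n : ℝ) * (n + y)⌋₊ (2 * n ^ 2)

lemma measurable_gridIndex (n : ℕ) : Measurable (gridIndex n) := by
  unfold gridIndex
  exact (Nat.measurable_floor.comp (by fun_prop)).min measurable_const

/-- Once `n > |y|` the cap in `gridIndex` is inactive and rounding down costs at most `1 / n`. -/
lemma tendsto_grid (y : ℝ) :
    Tendsto (fun n : ℕ ↦ -(n : ℝ) + gridIndex n y * (n : ℝ)⁻¹) atTop (𝓝 y) := by
  have hbig : ∀ᶠ n : ℕ in atTop, |y| < n :=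
    (tendsto_natCast_atTop_atTop.eventually_gt_atTop |y|)
  have hlim : Tendsto (fun n : ℕ ↦ y - (n : ℝ)⁻¹) atTop (𝓝 y) := by
    simpa using tendsto_inv_atTop_nhds_zero_nat.const_sub y
  refine tendsto_of_tendsto_of_tendsto_of_le_of_le' hlim tendsto_const_nhds ?_ ?_
  all_goals
    filter_upwards [hbig] with n hn
    have hy := abs_lt.mp hn
    have hn0 : (0 : ℝ) < n := (abs_nonneg y).trans_lt hn
    have hpos : 0 ≤ (n : ℝ) * (n + y) := mul_nonneg hn0.le (by linarith)
    have hidx : gridIndex n y = ⌊(n : ℝ) * (n + y)⌋₊ := by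
      refine min_eq_left (Nat.floor_le_of_le ?_)
      push_cast
      nlinarith
    rw [hidx, ← div_eq_mul_inv]
  · have h := (Nat.lt_floor_add_one ((n : ℝ) * (n + y))).le
    have : (n : ℝ) + y - (n : ℝ)⁻¹ ≤ ⌊(n : ℝ) * (n + y)⌋₊ / (n : ℝ) := by
      rw [le_div_iff₀ hn0, sub_mul, inv_mul_cancel₀ hn0.ne']
      linarith
    linarith
  · have h := Nat.floor_le hpos
    have : ⌊(n : ℝ) * (n + y)⌋₊ / (n : ℝ) ≤ (n : ℝ) + y := by
      rw [div_le_iff₀ hn0]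
      linarith
    linarith

/-- Rounding to the grid gives laws on finite arithmetic progressions, which is where dimension one
enters. Their characteristic functions converge pointwise by dominated convergence. -/
lemma dense_isQuasiInfinitelyDivisible_one :
    Dense {μ : ProbabilityMeasure 𝔼₁ | IsQuasiInfinitelyDivisible μ} := by
  intro μ
  let e : 𝔼₁ := EuclideanSpace.single 0 1
  let K : ℕ → 𝔼₁ → ℕ := fun n x ↦ gridIndex n (x 0)
  have hK (n : ℕ) : Measurable (K n) := (measurable_gridIndex n).comp (by fun_prop)
  have hKm (n : ℕ) (x : 𝔼₁) : K n x < 2 * n ^ 2 + 1 :=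
    Nat.lt_succ_of_le (min_le_right _ _)
  let w : ℕ → ℕ → ℝ := fun n k ↦ (μ : Measure 𝔼₁).real (K n ⁻¹' {k})
  have hw (n k : ℕ) : 0 ≤ w n k := measureReal_nonneg
  have hsum (n : ℕ) : ∑ k ∈ Finset.range (2 * n ^ 2 + 1), w n k = 1 := by
    have := sum_measureReal_preimage_mul (μ : Measure 𝔼₁) (hK n) (hKm n) fun _ ↦ 1
    simp only [mul_one, integral_const, probReal_univ, one_smul] at this
    exact_mod_cast this
  have hex (n : ℕ) := exists_charFun_eq_lattice (hw n) (hsum n) (-(n : ℝ) • e) ((n : ℝ)⁻¹ • e)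
  choose ν hν using hex
  refine isClosed_closure.mem_of_tendsto (b := atTop) (f := ν)
    (ProbabilityMeasure.tendsto_of_tendsto_charFun fun t ↦ ?_) (Eventually.of_forall fun n ↦
      mem_closure_isQuasiInfinitelyDivisible_of_lattice (hw n) (hsum n) (hν n))
  have hint (n : ℕ) : charFun (ν n : Measure 𝔼₁) t = ∫ x, Complex.exp
      ((((-(n : ℝ) + K n x * (n : ℝ)⁻¹) * t 0 : ℝ) : ℂ) * Complex.I) ∂(μ : Measure 𝔼₁) := by
    rw [hν, sum_measureReal_preimage_mul (μ : Measure 𝔼₁) (hK n) (hKm n)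
      fun k ↦ Complex.exp ((inner ℝ ((n : ℝ)⁻¹ • e) t : ℝ) * Complex.I) ^ k,
      ← integral_const_mul]
    refine integral_congr_ae (ae_of_all _ fun x ↦ ?_)
    simp only [← Complex.exp_nat_mul, ← Complex.exp_add, real_inner_smul_left, e,
      EuclideanSpace.inner_single_left]
    congr 1
    push_cast
    simp
    ring
  simp_rw [hint, charFun_apply]
  refine tendsto_integral_of_dominated_convergence (fun _ ↦ 1) (fun n ↦ ?_) (integrable_const _)
    (fun n ↦ ae_of_all _ fun x ↦ by rw [Complex.norm_exp_ofReal_mul_I]) (ae_of_all _ fun x ↦ ?_)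
  · have : Measurable fun x ↦ (K n x : ℝ) := measurable_from_top.comp (hK n)
    exact Measurable.aestronglyMeasurable (by fun_prop)
  · have hxt : inner ℝ x t = x 0 * t 0 := by
      simp [PiLp.inner_apply, mul_comm]
    rw [hxt]
    have hc : Continuous fun y : ℝ ↦ Complex.exp (((y * t 0 : ℝ) : ℂ) * Complex.I) := by fun_prop
    exact (hc.tendsto (x 0)).comp (tendsto_grid (x 0))

end Line

/-! ### Weak convergence and locally uniform convergence -/

section WeakConvergence

variable {E : Type*} [NormedAddCommGroup E] [MeasurableSpace E] [BorelSpace E]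

lemma integrable_min_two_mul_norm (μ : Measure E) [IsFiniteMeasure μ] {r : ℝ} (hr : 0 ≤ r) :
    Integrable (fun x : E ↦ min 2 (r * ‖x‖)) μ := by
  refine (integrable_const (2 : ℝ)).mono (by fun_prop) (ae_of_all _ fun x ↦ ?_)
  rw [Real.norm_of_nonneg (by positivity), Real.norm_of_nonneg (by norm_num)]
  exact min_le_left _ _

lemma tendsto_integral_min_two_mul_norm (μ : Measure E) [IsFiniteMeasure μ] :
    Tendsto (fun n : ℕ ↦ ∫ x, min 2 (1 / ((n : ℝ) + 1) * ‖x‖) ∂μ) atTop (𝓝 0) := by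
  have h := tendsto_integral_of_dominated_convergence
    (F := fun (n : ℕ) (x : E) ↦ min 2 (1 / ((n : ℝ) + 1) * ‖x‖)) (f := fun _ ↦ 0) (μ := μ)
    (fun _ ↦ 2) (fun n ↦ by fun_prop) (integrable_const _) (fun n ↦ ae_of_all _ fun x ↦ ?_)
    (ae_of_all _ fun x ↦ ?_)
  · simpa using h
  · rw [Real.norm_of_nonneg (by positivity)]
    exact min_le_left _ _
  · have : Tendsto (fun n : ℕ ↦ 1 / ((n : ℝ) + 1) * ‖x‖) atTop (𝓝 0) := by
      simpa using tendsto_one_div_add_atTop_nhds_zero_nat.mul_const ‖x‖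
    simpa using tendsto_const_nhds (x := (2 : ℝ)).min this

variable [InnerProductSpace ℝ E]

/-- Rests on `|exp (iu) - exp (iv)| ≤ min 2 |u - v|`. The truncation at `2` keeps the bound a
bounded continuous function of `x`, so that it passes to weak limits. -/
lemma norm_charFun_sub_le [SecondCountableTopology E] (μ : Measure E) [IsFiniteMeasure μ]
    {s t : E} {r : ℝ} (hr : ‖s - t‖ ≤ r) :
    ‖charFun μ s - charFun μ t‖ ≤ ∫ x, min 2 (r * ‖x‖) ∂μ := by
  rw [charFun_apply, charFun_apply,
    ← integral_sub (integrable_exp_inner μ s) (integrable_exp_inner μ t)]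
  refine norm_integral_le_of_norm_le
    (integrable_min_two_mul_norm μ ((norm_nonneg _).trans hr)) (ae_of_all _ fun x ↦ le_min ?_ ?_)
  · refine (norm_sub_le _ _).trans ?_
    simp only [Complex.norm_exp_ofReal_mul_I]
    norm_num
  · have h : Complex.exp ((inner ℝ x s : ℝ) * Complex.I) - Complex.exp ((inner ℝ x t : ℝ) * Complex.I)
        = Complex.exp ((inner ℝ x t : ℝ) * Complex.I)
          * (Complex.exp (Complex.I * (inner ℝ x (s - t) : ℝ)) - 1) := by
      rw [mul_sub, mul_one, ← Complex.exp_add, inner_sub_right]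
      congr 2
      push_cast
      ring
    rw [h, norm_mul, Complex.norm_exp_ofReal_mul_I, one_mul]
    refine (Real.norm_exp_I_mul_ofReal_sub_one_le).trans ?_
    refine (norm_inner_le_norm _ _).trans ?_
    rw [mul_comm]
    gcongr

/-- Characteristic functions converge locally uniformly along weakly convergent sequences. -/
lemma tendstoLocallyUniformly_charFun [FiniteDimensional ℝ E] {μ : ℕ → ProbabilityMeasure E}
    {μ₀ : ProbabilityMeasure E} (h : Tendsto μ atTop (𝓝 μ₀)) :
    TendstoLocallyUniformly (fun n t ↦ charFun (μ n : Measure E) t)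
      (charFun (μ₀ : Measure E)) atTop := by
  rw [Metric.tendstoLocallyUniformly_iff]
  intro ε hε t
  obtain ⟨k, hk⟩ := ((tendsto_integral_min_two_mul_norm (μ₀ : Measure E)).eventually_lt_const
    (show 0 < ε / 4 by positivity)).exists
  set r : ℝ := 1 / ((k : ℝ) + 1) with hr
  have hr0 : 0 < r := by positivity
  -- Testing weak convergence against this one function bounds the oscillation on the ball for all
  -- large `n` at once.
  let G : BoundedContinuousFunction E ℝ := BoundedContinuousFunction.ofNormedAddCommGroup
    (fun x ↦ min 2 (r * ‖x‖)) (by fun_prop) 2 fun x ↦ by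
      rw [Real.norm_of_nonneg (by positivity)]
      exact min_le_left _ _
  have hG := (ProbabilityMeasure.tendsto_iff_forall_integral_tendsto.mp h G).eventually_lt_const
    (show ∫ x, G x ∂(μ₀ : Measure E) < ε / 4 from hk)
  have ht := Metric.tendsto_nhds.mp (ProbabilityMeasure.tendsto_iff_tendsto_charFun.mp h t)
    (ε / 4) (by positivity)
  refine ⟨Metric.ball t r, Metric.ball_mem_nhds t hr0, ?_⟩
  filter_upwards [hG, ht] with n hn hn' s hs
  have hst : ‖s - t‖ ≤ r := by rw [← dist_eq_norm]; exact (Metric.mem_ball.mp hs).le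
  have h1 := norm_charFun_sub_le (μ₀ : Measure E) hst
  have h2 := norm_charFun_sub_le (μ n : Measure E) hst
  change ∫ x, min 2 (r * ‖x‖) ∂(μ n : Measure E) < ε / 4 at hn
  rw [dist_comm] at hn'
  calc dist (charFun (μ₀ : Measure E) s) (charFun (μ n : Measure E) s)
      ≤ dist (charFun (μ₀ : Measure E) s) (charFun (μ₀ : Measure E) t)
        + dist (charFun (μ₀ : Measure E) t) (charFun (μ n : Measure E) t)
        + dist (charFun (μ n : Measure E) t) (charFun (μ n : Measure E) s) :=
        dist_triangle4 _ _ _ _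
    _ < ε / 4 + ε / 4 + ε / 4 := by
        rw [dist_comm (charFun (μ n : Measure E) t)]
        rw [← dist_eq_norm] at h1 h2
        linarith
    _ < ε := by linarith

end WeakConvergence

/-! ### Density implies zero-free approximation -/

lemma IsQuasiInfinitelyDivisible.charFun_ne_zero {d : ℕ}
    {μ : ProbabilityMeasure (EuclideanSpace ℝ (Fin d))} (h : IsQuasiInfinitelyDivisible μ)
    (t : EuclideanSpace ℝ (Fin d)) :
    charFun (μ : Measure (EuclideanSpace ℝ (Fin d))) t ≠ 0 := by
  obtain ⟨μ₁, μ₂, h₁, h₂, h⟩ := h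
  rw [h]
  exact div_ne_zero (h₁.charFun_ne_zero t) (h₂.charFun_ne_zero t)

lemma isLocalUniformLimitOfZeroFree_of_mem_closure {d : ℕ}
    {μ : ProbabilityMeasure (EuclideanSpace ℝ (Fin d))}
    (h : μ ∈ closure {μ : ProbabilityMeasure (EuclideanSpace ℝ (Fin d)) |
      IsQuasiInfinitelyDivisible μ}) :
    IsLocalUniformLimitOfZeroFree (charFun (μ : Measure (EuclideanSpace ℝ (Fin d)))) := by
  obtain ⟨ν, hν, hlim⟩ := mem_closure_iff_seq_limit.mp h
  exact ⟨fun n ↦ charFun (ν n : Measure (EuclideanSpace ℝ (Fin d))),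
    fun n ↦ continuous_charFun _, fun n t ↦ (hν n).charFun_ne_zero t,
    tendstoLocallyUniformly_charFun hlim⟩

/-! ### The winding obstruction in dimension at least two -/

/-- `Complex.exp` is a covering of the punctured plane, so maps from simply connected, locally
path-connected spaces lift. -/
lemma exists_continuous_exp_eq {A : Type*} [TopologicalSpace A] [SimplyConnectedSpace A]
    [LocallyPathConnectedSpace A] {f : A → ℂ} (hf : Continuous f) (h0 : ∀ a, f a ≠ 0) :
    ∃ g : A → ℂ, Continuous g ∧ ∀ a, Complex.exp (g a) = f a := by
  obtain ⟨a₀⟩ : Nonempty A := inferInstance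
  obtain ⟨g, ⟨-, hg⟩, -⟩ := Complex.isCoveringMapOn_exp.existsUnique_continuousMap_lifts
    (⟨f, hf⟩ : C(A, ℂ)) (a₀ := a₀) (e₀ := Complex.log (f a₀)) (Complex.exp_log (h0 a₀)) h0
  exact ⟨g, g.continuous, fun a ↦ congrFun hg a⟩

/-- An argument stays in an open half-circle along a connected set on which the corresponding
rotated cosine is positive. -/
lemma abs_sub_lt_of_cos_pos {X : Type*} [TopologicalSpace X] {S : Set X} (hS : IsPreconnected S)
    {θ : X → ℝ} (hθ : ContinuousOn θ S) {c : ℝ} (hcos : ∀ x ∈ S, 0 < Real.cos (θ x - c))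
    {x₀ : X} (hx₀ : x₀ ∈ S) (h₀ : |θ x₀ - c| < Real.pi / 2) {x : X} (hx : x ∈ S) :
    |θ x - c| < Real.pi / 2 := by
  by_contra! hcon
  have hc : ContinuousOn (fun y ↦ |θ y - c|) S := (hθ.sub continuousOn_const).abs
  obtain ⟨y, hy, hy'⟩ := hS.intermediate_value hx₀ hx hc ⟨h₀.le, hcon⟩
  have := hcos y hy
  rw [← Real.cos_abs, show |θ y - c| = Real.pi / 2 from hy', Real.cos_pi_div_two] at this
  exact lt_irrefl _ this

/-- Used at the corners of the rectangle: there the value lies in two adjacent half-planes, so the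
half-circle confining the argument can be turned by a quarter. -/
lemma abs_sub_add_pi_div_two_lt_of_sin_pos {x c : ℝ} (h : |x - c| < Real.pi / 2)
    (hpos : 0 < Real.sin (x - c)) : |x - (c + Real.pi / 2)| < Real.pi / 2 := by
  rw [abs_lt] at h ⊢
  have : 0 < x - c := by
    by_contra! hle
    exact absurd (Real.sin_nonpos_of_nonpos_of_neg_pi_le hle (by linarith [Real.pi_pos]))
      (not_le.mpr hpos)
  constructor <;> linarith

/-- A continuous function on the plane whose values on the four sides of a rectangle lie in the
right, upper, left and lower half-planes respectively has a zero. -/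
lemma exists_zero_of_half_planes {f : ℝ × ℝ → ℂ} (hf : Continuous f) {a b c d : ℝ} (hab : a ≤ b)
    (hcd : c ≤ d) (h1 : ∀ y ∈ Set.Icc c d, 0 < (f (a, y)).re)
    (h2 : ∀ x ∈ Set.Icc a b, 0 < (f (x, d)).im)
    (h3 : ∀ y ∈ Set.Icc c d, (f (b, y)).re < 0)
    (h4 : ∀ x ∈ Set.Icc a b, (f (x, c)).im < 0) : ∃ p, f p = 0 := by
  by_contra! h0
  obtain ⟨g, hg, hgf⟩ := exists_continuous_exp_eq hf h0
  have hre (p) : (f p).re = Real.exp (g p).re * Real.cos (g p).im := by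
    rw [← hgf, Complex.exp_re]
  have him (p) : (f p).im = Real.exp (g p).re * Real.sin (g p).im := by
    rw [← hgf, Complex.exp_im]
  have hθ : Continuous fun p ↦ (g p).im := Complex.continuous_im.comp hg
  set θ : ℝ × ℝ → ℝ := fun p ↦ (g p).im
  have hcos {p} (h : 0 < (f p).re) : 0 < Real.cos (θ p) :=
    (mul_pos_iff_of_pos_left (Real.exp_pos _)).mp (hre p ▸ h)
  have hcos' {p} (h : (f p).re < 0) : Real.cos (θ p) < 0 :=
    neg_of_mul_neg_right (hre p ▸ h) (Real.exp_pos _).le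
  have hsin {p} (h : 0 < (f p).im) : 0 < Real.sin (θ p) :=
    (mul_pos_iff_of_pos_left (Real.exp_pos _)).mp (him p ▸ h)
  have hsin' {p} (h : (f p).im < 0) : Real.sin (θ p) < 0 :=
    neg_of_mul_neg_right (him p ▸ h) (Real.exp_pos _).le
  have hc : c ∈ Set.Icc c d := Set.left_mem_Icc.mpr hcd
  have hd : d ∈ Set.Icc c d := Set.right_mem_Icc.mpr hcd
  have ha : a ∈ Set.Icc a b := Set.left_mem_Icc.mpr hab
  have hb : b ∈ Set.Icc a b := Set.right_mem_Icc.mpr hab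
  -- the argument, normalised at the corner `(a, c)`
  obtain ⟨k, hk⟩ : ∃ k : ℤ, |θ (a, c) - k * (2 * Real.pi)| < Real.pi / 2 := by
    have := hcos (h1 c hc)
    refine ⟨toIocDiv Real.two_pi_pos (-Real.pi) (θ (a, c)), ?_⟩
    set k := toIocDiv Real.two_pi_pos (-Real.pi) (θ (a, c)) with hkdef
    have hmem := toIocMod_mem_Ioc Real.two_pi_pos (-Real.pi) (θ (a, c))
    rw [toIocMod, ← hkdef, zsmul_eq_mul] at hmem
    rw [← Real.cos_sub_int_mul_two_pi _ k] at this
    by_contra! hcon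
    rw [← Real.cos_abs] at this
    refine absurd (Real.cos_nonpos_of_pi_div_two_le_of_le hcon ?_) (not_le.mpr this)
    rw [abs_le]
    constructor <;> linarith [hmem.1, hmem.2, Real.pi_pos]
  set m : ℝ := k * (2 * Real.pi) with hm
  have hcosm (x : ℝ) : Real.cos (x - m) = Real.cos x := Real.cos_sub_int_mul_two_pi _ k
  have hsinm (x : ℝ) : Real.sin (x - m) = Real.sin x := Real.sin_sub_int_mul_two_pi _ k
  have vert (x₀ : ℝ) : ContinuousOn (fun y ↦ θ (x₀, y)) (Set.Icc c d) :=
    (hθ.comp (by fun_prop : Continuous fun y : ℝ ↦ (x₀, y))).continuousOn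
  have horiz (y₀ : ℝ) : ContinuousOn (fun x ↦ θ (x, y₀)) (Set.Icc a b) :=
    (hθ.comp (by fun_prop : Continuous fun x : ℝ ↦ (x, y₀))).continuousOn
  -- The boundary is followed through `(a, d)`, `(b, d)`, `(b, c)` back to `(a, c)`; the centre of
  -- the half-circle advances by `π / 2` at each of the three intermediate corners.
  have hA : |θ (a, d) - m| < Real.pi / 2 :=
    abs_sub_lt_of_cos_pos isPreconnected_Icc (vert a)
      (fun y hy ↦ (hcosm _).symm ▸ hcos (h1 y hy)) hc hk hd
  have e1 (x : ℝ) : Real.cos (x - (m + Real.pi / 2)) = Real.sin x := by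
    rw [← sub_sub, Real.cos_sub_pi_div_two, hsinm]
  have e1' (x : ℝ) : Real.sin (x - (m + Real.pi / 2)) = -Real.cos x := by
    rw [← sub_sub, Real.sin_sub_pi_div_two, hcosm]
  have e2 (x : ℝ) : Real.cos (x - (m + Real.pi / 2 + Real.pi / 2)) = -Real.cos x := by
    rw [← sub_sub, Real.cos_sub_pi_div_two, e1']
  have e2' (x : ℝ) : Real.sin (x - (m + Real.pi / 2 + Real.pi / 2)) = -Real.sin x := by
    rw [← sub_sub, Real.sin_sub_pi_div_two, e1]
  have e3 (x : ℝ) :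
      Real.cos (x - (m + Real.pi / 2 + Real.pi / 2 + Real.pi / 2)) = -Real.sin x := by
    rw [← sub_sub, Real.cos_sub_pi_div_two, e2']
  have e3' (x : ℝ) :
      Real.sin (x - (m + Real.pi / 2 + Real.pi / 2 + Real.pi / 2)) = Real.cos x := by
    rw [← sub_sub, Real.sin_sub_pi_div_two, e2, neg_neg]
  have hB : |θ (b, d) - (m + Real.pi / 2)| < Real.pi / 2 :=
    abs_sub_lt_of_cos_pos isPreconnected_Icc (horiz d)
      (fun x hx ↦ (e1 _).symm ▸ hsin (h2 x hx)) ha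
      (abs_sub_add_pi_div_two_lt_of_sin_pos hA ((hsinm _).symm ▸ hsin (h2 a ha))) hb
  have hC : |θ (b, c) - (m + Real.pi / 2 + Real.pi / 2)| < Real.pi / 2 :=
    abs_sub_lt_of_cos_pos isPreconnected_Icc (vert b)
      (fun y hy ↦ (e2 _).symm ▸ neg_pos.mpr (hcos' (h3 y hy))) hd
      (abs_sub_add_pi_div_two_lt_of_sin_pos hB ((e1' _).symm ▸ neg_pos.mpr (hcos' (h3 d hd)))) hc
  have hD : |θ (a, c) - (m + Real.pi / 2 + Real.pi / 2 + Real.pi / 2)| < Real.pi / 2 :=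
    abs_sub_lt_of_cos_pos isPreconnected_Icc (horiz c)
      (fun x hx ↦ (e3 _).symm ▸ neg_pos.mpr (hsin' (h4 x hx))) hb
      (abs_sub_add_pi_div_two_lt_of_sin_pos hC ((e2' _).symm ▸ neg_pos.mpr (hsin' (h4 b hb)))) ha
  -- At the same corner `hk` puts the argument below `m + π / 2`, while `hD` puts it above `m + π`.
  rw [abs_lt] at hk hD
  linarith [hk.2, hD.1, Real.pi_pos]

/-- The margin `ε` lets the boundary signs survive an approximation uniform on the compact image of
the rectangle, so the approximant has a zero. -/
lemma not_isLocalUniformLimitOfZeroFree_of_half_planes {n : ℕ} {φ : EuclideanSpace ℝ (Fin n) → ℂ}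
    {L : ℝ × ℝ → EuclideanSpace ℝ (Fin n)} (hL : Continuous L) {a b c d ε : ℝ} (hε : 0 < ε)
    (hab : a ≤ b) (hcd : c ≤ d) (h1 : ∀ y, ε ≤ (φ (L (a, y))).re)
    (h2 : ∀ x, ε ≤ (φ (L (x, d))).im) (h3 : ∀ y, (φ (L (b, y))).re ≤ -ε)
    (h4 : ∀ x, (φ (L (x, c))).im ≤ -ε) : ¬ IsLocalUniformLimitOfZeroFree φ := by
  rintro ⟨f, hf, hf0, hlim⟩
  have hK : IsCompact (L '' (Set.Icc a b ×ˢ Set.Icc c d)) :=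
    (isCompact_Icc.prod isCompact_Icc).image hL
  have hu := (tendstoLocallyUniformlyOn_iff_tendstoUniformlyOn_of_compact hK).mp
    hlim.tendstoLocallyUniformlyOn
  obtain ⟨m, hm⟩ := (Metric.tendstoUniformlyOn_iff.mp hu ε hε).exists
  have key {x y : ℝ} (hx : x ∈ Set.Icc a b) (hy : y ∈ Set.Icc c d) :
      |(φ (L (x, y))).re - (f m (L (x, y))).re| < ε ∧
        |(φ (L (x, y))).im - (f m (L (x, y))).im| < ε := by
    have := hm (L (x, y)) (Set.mem_image_of_mem L ⟨hx, hy⟩)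
    rw [dist_eq_norm] at this
    exact ⟨(Complex.abs_re_le_norm _).trans_lt this, (Complex.abs_im_le_norm _).trans_lt this⟩
  have hc : c ∈ Set.Icc c d := Set.left_mem_Icc.mpr hcd
  have hd : d ∈ Set.Icc c d := Set.right_mem_Icc.mpr hcd
  have ha : a ∈ Set.Icc a b := Set.left_mem_Icc.mpr hab
  have hb : b ∈ Set.Icc a b := Set.right_mem_Icc.mpr hab
  obtain ⟨p, hp⟩ := exists_zero_of_half_planes ((hf m).comp hL) hab hcd
    (fun y hy ↦ by
      have := abs_lt.mp (key ha hy).1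
      change 0 < (f m (L (a, y))).re
      linarith [h1 y])
    (fun x hx ↦ by
      have := abs_lt.mp (key hx hd).2
      change 0 < (f m (L (x, d))).im
      linarith [h2 x])
    (fun y hy ↦ by
      have := abs_lt.mp (key hb hy).1
      change (f m (L (b, y))).re < 0
      linarith [h3 y])
    (fun x hx ↦ by
      have := abs_lt.mp (key hx hc).2
      change (f m (L (x, c))).im < 0
      linarith [h4 x])
  exact hf0 m _ hp

lemma exists_not_isLocalUniformLimitOfZeroFree {d : ℕ} (hd : 2 ≤ d) :
    ∃ μ : ProbabilityMeasure (EuclideanSpace ℝ (Fin d)),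
      ¬ IsLocalUniformLimitOfZeroFree (charFun (μ : Measure (EuclideanSpace ℝ (Fin d)))) := by
  let i : Fin d := ⟨0, by omega⟩
  let j : Fin d := ⟨1, by omega⟩
  have hij : i ≠ j := by simp [i, j]
  let e : Fin d → EuclideanSpace ℝ (Fin d) := fun k ↦ EuclideanSpace.single k 1
  -- The pair `± e i` contributes the real term `2 cos x`, which changes sign; the unpaired atom `e
  -- j` supplies the imaginary part `sin y`.
  obtain ⟨μ, hμ⟩ := exists_charFun_eq_sum (Finset.univ : Finset (Fin 3)) (w := fun _ ↦ 1 / 3)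
    (fun _ ↦ by norm_num) (by simp) ![e i, -e i, e j]
  let L : ℝ × ℝ → EuclideanSpace ℝ (Fin d) := fun p ↦ p.1 • e i + p.2 • e j
  have hi (p) : inner ℝ (e i) (L p) = p.1 := by
    simp [e, L, inner_add_right, EuclideanSpace.inner_single_left, hij]
  have hj (p) : inner ℝ (e j) (L p) = p.2 := by
    simp [e, L, inner_add_right, EuclideanSpace.inner_single_left, hij.symm]
  have hφ (p) : charFun (μ : Measure (EuclideanSpace ℝ (Fin d))) (L p)
      = ((1 / 3 : ℝ) : ℂ) * (Complex.exp ((p.1 : ℝ) * Complex.I)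
        + Complex.exp ((-p.1 : ℝ) * Complex.I) + Complex.exp ((p.2 : ℝ) * Complex.I)) := by
    rw [hμ, Fin.sum_univ_three]
    simp only [Matrix.cons_val_zero, Matrix.cons_val_one, Matrix.cons_val, inner_neg_left, hi, hj]
    ring
  have hre (p) : (charFun (μ : Measure (EuclideanSpace ℝ (Fin d))) (L p)).re
      = 1 / 3 * (2 * Real.cos p.1 + Real.cos p.2) := by
    rw [hφ, Complex.re_ofReal_mul]
    simp only [Complex.add_re, Complex.exp_ofReal_mul_I_re, Real.cos_neg]
    ring
  have him (p) : (charFun (μ : Measure (EuclideanSpace ℝ (Fin d))) (L p)).im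
      = 1 / 3 * Real.sin p.2 := by
    rw [hφ, Complex.im_ofReal_mul]
    simp only [Complex.add_im, Complex.exp_ofReal_mul_I_im, Real.sin_neg]
    ring
  -- On `x = 0` and `x = π` the term `2 cos x = ± 2` dominates `cos y`; on `y = ± π / 2` the
  -- imaginary part is `± 1 / 3`. Hence the margin `1 / 3`.
  refine ⟨μ, not_isLocalUniformLimitOfZeroFree_of_half_planes (L := L) (a := 0) (b := Real.pi)
    (c := -(Real.pi / 2)) (d := Real.pi / 2) (ε := 1 / 3) (by fun_prop) (by norm_num)
    Real.pi_pos.le (by linarith [Real.pi_pos]) (fun y ↦ ?_) (fun x ↦ ?_) (fun y ↦ ?_)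
    (fun x ↦ ?_)⟩
  · rw [hre, Real.cos_zero]
    linarith [Real.neg_one_le_cos y]
  · simp [him]
  · rw [hre, Real.cos_pi]
    linarith [Real.cos_le_one y]
  · simp [him]

theorem mainTheorem2 (d : ℕ) (hd : 1 ≤ d) :
    List.TFAE [
      Dense {μ : ProbabilityMeasure (EuclideanSpace ℝ (Fin d)) | IsQuasiInfinitelyDivisible μ},
      ∀ μ : ProbabilityMeasure (EuclideanSpace ℝ (Fin d)),
        IsLocalUniformLimitOfZeroFree (charFun (μ : Measure (EuclideanSpace ℝ (Fin d)))),
      d = 1] := by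
  tfae_have 1 → 2 := fun h μ ↦ isLocalUniformLimitOfZeroFree_of_mem_closure (h μ)
  tfae_have 2 → 3 := by
    intro h
    by_contra hne
    obtain ⟨μ, hμ⟩ := exists_not_isLocalUniformLimitOfZeroFree (d := d) (by omega)
    exact hμ (h μ)
  tfae_have 3 → 1 := by
    rintro rfl
    exact dense_isQuasiInfinitelyDivisible_one
  tfae_finish
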